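/- Let $n<m$ be positive integers. An $n\times m$ integer matrix $M$ is called rectangular unimodular if one can adjoin $m-n$ rows from $\mathbb{Z}^m$ to $M$ such that the resulting $m\times m$ matrix $\overline{M}$ is invertible over $\mathbb{Z}$, i.e. $\det(\overline{M})\in\{1,-1\}$. The density of a set $S\subseteq\mathbb{Z}^d$ is $$\rho(S)=\lim_{B\to\infty}\frac{\left|S\cap[-B,B[^d\right|}{(2B)^d},$$ if this limit exists. Then, identifying the $n\times m$ integer matrices with $\mathbb{Z}^{nm}$, the set of rectangular unimodular $n\times m$ integer matrices has a density, and it equals $$\prod_{i=0}^{n-1}\frac{1}{\zeta(m-i)},$$ where $\zeta$ is the Riemann zeta function. -/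

import Mathlib

open Filter Topology

/-- An `n × m` matrix `M` with `n < m` over a domain is rectangular unimodular if `m - n` further
rows can be adjoined to it so that the resulting `m × m` matrix is invertible. The first `n` rows
of `Mbar` are those of `M`; the remaining `m - n` rows are the adjoined ones. -/
def IsRectangularUnimodular {R : Type*} [CommRing R] [IsDomain R] {n m : ℕ} (h : n < m)
    (M : Matrix (Fin n) (Fin m) R) : Prop :=
  ∃ Mbar : Matrix (Fin m) (Fin m) R,
    (∀ (i : Fin n) (j : Fin m), Mbar (Fin.castLE h.le i) j = M i j) ∧ IsUnit Mbar.det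

/-- The integer points of the half-open cube `[-B, B[ ^ ι`. -/
def integerBox (ι : Type*) (B : ℝ) : Set (ι → ℤ) :=
  {x | ∀ i, (x i : ℝ) ∈ Set.Ico (-B) B}

/-- `S ⊆ ℤ ^ ι` has density `d`: the limit of `|S ∩ [-B, B[ ^ ι| / (2 B) ^ |ι|` as `B → ∞` exists
and equals `d`. -/
def HasDensity {ι : Type*} [Fintype ι] (S : Set (ι → ℤ)) (d : ℝ) : Prop :=
  Tendsto (fun B : ℝ => ((S ∩ integerBox ι B).ncard : ℝ) / (2 * B) ^ Fintype.card ι) atTop (𝓝 d)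

/-- The set of `n × m` rectangular unimodular integer matrices, as a subset of `ℤ ^ (n m)`. -/
def rectangularUnimodularSet {n m : ℕ} (h : n < m) : Set (Fin n × Fin m → ℤ) :=
  {x | IsRectangularUnimodular h (Matrix.of fun i j => x (i, j))}

/-! An integer matrix is rectangular unimodular exactly when its rows are independent modulo every
prime: otherwise the image in `ℤ^n` is proper and lies in the kernel of a nonzero form modulo some
prime, while a surjection `ℤ^m → ℤ^n` splits with free kernel, which supplies the missing rows.

For finitely many primes the Chinese remainder theorem makes the conditions independent, so the
density is the product of the local factors `∏ (1 - p^{-(m-i)})`, which tends to the product of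
inverse zeta values by the Euler product.

Passing to all primes needs a tail bound uniform in the box, of side `L`. For `P < p ≤ L`, counting
residues gives a proportion `O(p⁻²)`, with sum `O(1/P)` (`card_box_not_rowsIndepMod_le`). For `p >
L` residues say nothing; instead `exists_card_minors_dvd_le` shows by induction on `n` that only a
proportion `O(1/L)` of matrices have all maximal minors divisible by one such prime. Then
`tendsto_of_abs_sub_le` interchanges the limits. -/

/-! ### Unimodularity as a condition modulo each prime -/

/-- The rows of the integer matrix with entries `x (i, j)` are linearly independent modulo `p`. -/
def RowsIndepMod {n m : ℕ} (p : ℕ) (x : Fin n × Fin m → ℤ) : Prop :=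
  LinearIndependent (ZMod p) fun (i : Fin n) (j : Fin m) => (x (i, j) : ZMod p)

/-- A proper finitely generated subgroup of `ℤ ^ n` lies in the kernel of a nonzero linear form
modulo some prime. -/
theorem exists_prime_linearForm_of_ne_top {n : ℕ} (N : Submodule ℤ (Fin n → ℤ)) (hN : N ≠ ⊤) :
    ∃ (p : ℕ) (c : Fin n → ZMod p), p.Prime ∧ c ≠ 0 ∧
      ∀ y ∈ N, ∑ i, (y i : ZMod p) * c i = 0 := by
  obtain ⟨K, hK, hNK⟩ := (eq_top_or_exists_le_coatom N).resolve_left hN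
  have hs : IsSimpleModule ℤ ((Fin n → ℤ) ⧸ K) := isSimpleModule_iff_isCoatom.2 hK
  obtain ⟨I, hI, ⟨e⟩⟩ := isSimpleModule_iff_quot_maximal.1 hs
  obtain ⟨p, rfl⟩ : ∃ p : ℕ, I = Ideal.span {(p : ℤ)} := by
    obtain ⟨a, rfl⟩ := (IsPrincipalIdealRing.principal I).principal
    exact ⟨a.natAbs, by rw [Int.span_natAbs]⟩
  have hp0 : p ≠ 0 := by
    rintro rfl
    exact Ring.ne_bot_of_isMaximal_of_not_isField hI Int.not_isField (by simp)
  have hp : p.Prime := by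
    have := (Ideal.span_singleton_prime (by exact_mod_cast hp0)).1 hI.isPrime
    exact Nat.prime_iff_prime_int.2 this
  -- The quotient by a maximal subgroup is simple, hence `ℤ/p`; the form has as coefficients the
  -- images of the standard basis.
  let φ : (Fin n → ℤ) →+ ZMod p :=
    (Int.quotientSpanNatEquivZMod p).toAddEquiv.toAddMonoidHom.comp
      (e.toLinearMap.comp K.mkQ).toAddMonoidHom
  have hφ : ∀ y, φ y = ∑ i, (y i : ZMod p) * φ (Pi.single i 1) := by
    intro y
    conv_lhs => rw [pi_eq_sum_univ' y]
    rw [map_sum]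
    refine Finset.sum_congr rfl fun i _ => ?_
    rw [map_zsmul, zsmul_eq_mul]
  have hφK : ∀ y, φ y = 0 ↔ y ∈ K := by
    intro y
    simp [φ]
  refine ⟨p, fun i => φ (Pi.single i 1), hp, ?_, ?_⟩
  · intro h0
    apply hK.1
    rw [eq_top_iff]
    intro y _
    rw [← hφK, hφ]
    exact Finset.sum_eq_zero fun i _ => by rw [congrFun h0 i]; simp
  · intro y hy
    rw [← hφ, hφK]
    exact hNK hy

/-- A nonzero form modulo `p` that kills the image kills every column, which is a linear relation
between the rows. -/
theorem mulVecLin_surjective_of_rowsIndepMod {n m : ℕ} (x : Fin n × Fin m → ℤ)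
    (h : ∀ p : ℕ, p.Prime → RowsIndepMod p x) :
    Function.Surjective (Matrix.of fun i j => x (i, j)).mulVecLin := by
  rw [← LinearMap.range_eq_top]
  by_contra hN
  obtain ⟨p, c, hp, hc, hcy⟩ := exists_prime_linearForm_of_ne_top _ hN
  apply hc
  have := Fintype.linearIndependent_iff.1 (h p hp) c ?_
  · exact funext this
  · ext j
    have := hcy _ (LinearMap.mem_range_self _ (Pi.single j 1))
    simpa [mul_comm] using this

/-- A surjective integer matrix can be completed to an invertible one. -/
theorem isRectangularUnimodular_of_surjective {n m : ℕ} (h : n < m) (M : Matrix (Fin n) (Fin m) ℤ)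
    (hM : Function.Surjective M.mulVecLin) : IsRectangularUnimodular h M := by
  obtain ⟨k, rfl⟩ := Nat.exists_eq_add_of_le h.le
  set f := M.mulVecLin with hf
  obtain ⟨s, hs⟩ := LinearMap.exists_rightInverse_of_surjective f (LinearMap.range_eq_top.2 hM)
  have hfs : ∀ y, f (s y) = y := fun y => LinearMap.congr_fun hs y
  -- The splitting `x ↦ (f x, x - s (f x))` given by the section `s`.
  let e : (Fin (n + k) → ℤ) ≃ₗ[ℤ] (Fin n → ℤ) × LinearMap.ker f :=
    LinearEquiv.ofLinearMap
      (f.prod ((LinearMap.id - s ∘ₗ f).codRestrict (LinearMap.ker f) fun x => by simp [hfs]))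
      (s.coprod (LinearMap.ker f).subtype)
      (by
        refine LinearMap.ext fun y => Prod.ext ?_ (Subtype.ext ?_)
        · simp [hfs]
        · have := y.2.2
          simp [hfs])
      (by ext1; simp)
  have hrank : Module.finrank ℤ (LinearMap.ker f) = k := by
    have := e.finrank_eq
    rw [Module.finrank_prod] at this
    simpa using this.symm
  let b : LinearMap.ker f ≃ₗ[ℤ] (Fin k → ℤ) :=
    (Module.finBasisOfFinrankEq ℤ (LinearMap.ker f) hrank).equivFun
  -- The first `n` coordinates of this automorphism are those of `f`, so its matrix starts with the
  -- rows of `M`.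
  let e' : (Fin (n + k) → ℤ) ≃ₗ[ℤ] (Fin (n + k) → ℤ) :=
    e ≪≫ₗ ((LinearEquiv.refl ℤ (Fin n → ℤ)).prodCongr b) ≪≫ₗ
      (LinearEquiv.sumArrowLequivProdArrow (Fin n) (Fin k) ℤ ℤ).symm ≪≫ₗ
      LinearEquiv.funCongrLeft ℤ ℤ finSumFinEquiv.symm
  refine ⟨LinearMap.toMatrix' e'.toLinearMap, fun i j => ?_, ?_⟩
  · have : Fin.castLE h.le i = Fin.castAdd k i := rfl
    rw [LinearMap.toMatrix'_apply, this]
    simp [e', e, hf, LinearMap.funLeft]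
  · rw [LinearMap.det_toMatrix']
    exact LinearEquiv.isUnit_det' e'

theorem isRectangularUnimodular_iff_rowsIndepMod {n m : ℕ} (h : n < m) (x : Fin n × Fin m → ℤ) :
    IsRectangularUnimodular h (Matrix.of fun i j => x (i, j)) ↔
      ∀ p : ℕ, p.Prime → RowsIndepMod p x := by
  refine ⟨?_, fun hx => isRectangularUnimodular_of_surjective h _
    (mulVecLin_surjective_of_rowsIndepMod x hx)⟩
  rintro ⟨Mbar, hMbar, hdet⟩ p hp
  have : Fact p.Prime := ⟨hp⟩
  have hu : IsUnit (Mbar.map (Int.castRingHom (ZMod p))) := by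
    rw [Matrix.isUnit_iff_isUnit_det, ← RingHom.mapMatrix_apply, ← RingHom.map_det]
    exact hdet.map _
  have hli := (Matrix.linearIndependent_rows_iff_isUnit.2 hu).comp _ (Fin.castLE_injective h.le)
  have he : (fun (i : Fin n) (j : Fin m) => (x (i, j) : ZMod p)) =
      (Mbar.map (Int.castRingHom (ZMod p))).row ∘ Fin.castLE h.le := by
    funext i j
    exact congrArg (Int.cast : ℤ → ZMod p) (hMbar i j).symm
  unfold RowsIndepMod
  rw [he]
  exact hli

/-! ### Primes larger than the side of the box -/

/-- With more than `k + K` such primes, `k` of them multiply to at least `L ^ k` and the others,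
each at least 2, to at least `2 ^ (K + 1) > K`, which exceeds `D`. -/
theorem card_filter_primeFactors_le {D K L k : ℕ} (hD : D ≠ 0) (hle : D ≤ K * L ^ k) :
    (D.primeFactors.filter (L < ·)).card ≤ k + K := by
  set T := D.primeFactors.filter (L < ·)
  by_contra! hT
  have hL : 1 ≤ L ∨ k = 0 := by
    by_contra! h
    obtain ⟨_, h2⟩ := h
    have : L = 0 := by omega
    simp [this, h2] at hle
    exact hD hle
  have h2 : 2 ^ (T.card - k) * L ^ k ≤ ∏ p ∈ T, p := by
    obtain ⟨S, hST, hS⟩ := Finset.exists_subset_card_eq (s := T) (n := k) (by omega)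
    rw [← Finset.prod_sdiff hST]
    refine Nat.mul_le_mul ?_ ?_
    · rw [← hS, ← Finset.card_sdiff_of_subset hST]
      exact Finset.pow_card_le_prod _ _ _ fun p hp =>
        (Nat.prime_of_mem_primeFactors
          (Finset.mem_filter.1 (Finset.mem_sdiff.1 hp).1).1).two_le
    · rw [← hS]
      exact Finset.pow_card_le_prod _ _ _ fun p hp =>
        (Finset.mem_filter.1 (hST hp)).2.le
  have h3 : ∏ p ∈ T, p ≤ D :=
    (Finset.prod_le_prod_of_subset_of_one_le' (Finset.filter_subset _ _)
      fun p hp _ => (Nat.prime_of_mem_primeFactors hp).one_le).trans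
      (Nat.le_of_dvd (Nat.pos_of_ne_zero hD) (Nat.prod_primeFactors_dvd D))
  have h4 : K < 2 ^ (T.card - k) :=
    (by omega : K < T.card - k).trans Nat.lt_two_pow_self
  have h5 : 0 < L ^ k := by
    rcases hL with hL | rfl
    · positivity
    · simp
  have := Nat.mul_lt_mul_of_pos_right h4 h5
  omega

/-- The other coordinates determine the `i`-th modulo `p`, hence determine it, since an interval of
length `L < p` meets each residue class at most once. -/
theorem card_box_dvd_le {k L p : ℕ} {a b : ℤ} (hL : b - a = L) (hp : p.Prime) (hLp : L < p)
    (c : Fin (k + 1) → ℤ) (i : Fin (k + 1)) (hi : ¬ (p : ℤ) ∣ c i) :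
    ((Fintype.piFinset fun _ : Fin (k + 1) => Finset.Ico a b).filter
      fun u => (p : ℤ) ∣ ∑ i, c i * u i).card ≤ L ^ k := by
  have hcard : (Fintype.piFinset fun _ : Fin k => Finset.Ico a b).card = L ^ k := by
    simp [Fintype.card_piFinset, hL]
  rw [← hcard]
  refine Finset.card_le_card_of_injOn (fun u => i.removeNth u) ?_ ?_
  · intro u hu
    simp only [Finset.coe_filter, Set.mem_ofPred_eq, Fintype.mem_piFinset] at hu
    simp only [Finset.mem_coe, Fintype.mem_piFinset]
    exact fun j => hu.1 _
  · intro u hu v hv huv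
    simp only [Finset.coe_filter, Set.mem_ofPred_eq, Fintype.mem_piFinset, Finset.mem_Ico] at hu hv
    have hj : ∀ j, u (i.succAbove j) = v (i.succAbove j) := fun j => congrFun huv j
    have hd := dvd_sub hu.2 hv.2
    rw [Fin.sum_univ_succAbove _ i, Fin.sum_univ_succAbove _ i] at hd
    simp only [hj, add_sub_add_right_eq_sub, ← mul_sub] at hd
    have hd' := ((Nat.prime_iff_prime_int.1 hp).dvd_or_dvd hd).resolve_left hi
    have h0 : u i - v i = 0 := by
      refine Int.eq_zero_of_abs_lt_dvd hd' ?_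
      have h1 := hu.1 i
      have h2 := hv.1 i
      rw [abs_lt]
      constructor <;> omega
    funext j
    rcases Fin.eq_self_or_eq_succAbove i j with rfl | ⟨l, rfl⟩
    · omega
    · exact hj l

-- If the form is nonzero at the first vector, its value there has boundedly many prime factors
-- above `L`, and each confines the second vector to at most `L ^ k` points. If it vanishes there,
-- the first vector is itself confined to at most `L ^ k` points.
open Classical in
theorem card_pairs_dvd_le {k L K : ℕ} {a b : ℤ} (hL : b - a = L) (ha : -L ≤ a) (hb : b ≤ L)
    (c : Fin (k + 1) → ℤ) (hc : ∀ p : ℕ, p.Prime → L < p → ∃ i, ¬ (p : ℤ) ∣ c i)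
    (hK : ∀ i, |c i| ≤ K * L ^ k) :
    (((Fintype.piFinset fun _ : Fin (k + 1) => Finset.Ico a b) ×ˢ
        (Fintype.piFinset fun _ : Fin (k + 1) => Finset.Ico a b)).filter
      fun w : (Fin (k + 1) → ℤ) × (Fin (k + 1) → ℤ) => ∃ p : ℕ, p.Prime ∧ L < p ∧
        (p : ℤ) ∣ ∑ i, c i * w.1 i ∧ (p : ℤ) ∣ ∑ i, c i * w.2 i).card ≤
      (1 + (k + 1 + (k + 1) * K)) * L ^ (2 * k + 1) := by
  set X := Fintype.piFinset fun _ : Fin (k + 1) => Finset.Ico a b with hX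
  have hXcard : X.card = L ^ (k + 1) := by simp [hX, Fintype.card_piFinset, hL]
  -- Any prime above `L` serves to count the zeros of the form: a zero over `ℤ` is a zero modulo
  -- `q`.
  obtain ⟨q, hLq, hq⟩ := Nat.exists_infinite_primes (L + 1)
  obtain ⟨iq, hiq⟩ := hc q hq hLq
  let D : (Fin (k + 1) → ℤ) → ℕ := fun u => (∑ i, c i * u i).natAbs
  let T : (Fin (k + 1) → ℤ) → Finset ℕ := fun u => (D u).primeFactors.filter (L < ·)
  have hT : ∀ u ∈ X, (T u).card ≤ k + 1 + (k + 1) * K := by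
    intro u hu
    by_cases h0 : D u = 0
    · simp [T, h0]
    · refine card_filter_primeFactors_le h0 ?_
      have : |∑ i, c i * u i| ≤ (k + 1) * K * L ^ (k + 1) := by
        refine (Finset.abs_sum_le_sum_abs _ _).trans ?_
        have : ∀ i ∈ Finset.univ, |c i * u i| ≤ K * L ^ k * L := by
          intro i _
          rw [abs_mul]
          have hui := (Fintype.mem_piFinset.1 hu) i
          rw [Finset.mem_Ico] at hui
          exact mul_le_mul (hK i) (abs_le.2 ⟨by omega, by omega⟩) (abs_nonneg _) (by positivity)
        refine (Finset.sum_le_card_nsmul _ _ _ this).trans (le_of_eq ?_)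
        simp
        ring
      zify
      simpa [D] using this
  have hsub : ((X ×ˢ X).filter fun w : (Fin (k + 1) → ℤ) × (Fin (k + 1) → ℤ) =>
        ∃ p : ℕ, p.Prime ∧ L < p ∧ (p : ℤ) ∣ ∑ i, c i * w.1 i ∧
        (p : ℤ) ∣ ∑ i, c i * w.2 i) ⊆
      (X.filter fun u => (q : ℤ) ∣ ∑ i, c i * u i) ×ˢ X ∪
      X.biUnion fun u => (T u).biUnion fun p =>
        {u} ×ˢ (X.filter fun v => L < p ∧ p.Prime ∧ (p : ℤ) ∣ ∑ i, c i * v i) := by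
    rintro ⟨u, v⟩ h
    simp only [Finset.mem_filter, Finset.mem_product] at h
    obtain ⟨⟨hu, hv⟩, p, hp, hLp, hpu, hpv⟩ := h
    simp only [Finset.mem_union, Finset.mem_product, Finset.mem_filter, Finset.mem_biUnion,
      Finset.mem_singleton]
    by_cases h0 : ∑ i, c i * u i = 0
    · exact Or.inl ⟨⟨hu, by simp [h0]⟩, hv⟩
    · refine Or.inr ⟨u, hu, p, ?_, rfl, hv, hLp, hp, hpv⟩
      simp only [T, D, Finset.mem_filter, Nat.mem_primeFactors]
      exact ⟨⟨hp, Int.natCast_dvd.1 hpu, by simpa using h0⟩, hLp⟩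
  refine (Finset.card_le_card hsub).trans ((Finset.card_union_le _ _).trans ?_)
  rw [add_mul, one_mul]
  refine add_le_add ?_ ?_
  · rw [Finset.card_product, hXcard]
    refine (Nat.mul_le_mul_right _ (card_box_dvd_le hL hq hLq c iq hiq)).trans (le_of_eq ?_)
    ring
  · refine (Finset.card_biUnion_le_card_mul _ _
      ((k + 1 + (k + 1) * K) * L ^ k) fun u hu => ?_).trans (le_of_eq ?_)
    · refine (Finset.card_biUnion_le_card_mul _ _ (L ^ k) fun p hp => ?_).trans
        (Nat.mul_le_mul_right _ (hT u hu))
      rw [Finset.card_product, Finset.card_singleton, one_mul]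
      by_cases h : L < p ∧ p.Prime
      · obtain ⟨i, hi⟩ := hc p h.2 h.1
        refine le_trans (Finset.card_le_card fun v hv => ?_) (card_box_dvd_le hL h.2 h.1 c i hi)
        simp only [Finset.mem_filter] at hv ⊢
        exact ⟨hv.1, hv.2.2.2⟩
      · rw [Finset.filter_false_of_mem]
        · simp
        · intro v _ hv
          exact h ⟨hv.1, hv.2.1⟩
    · rw [hXcard]
      ring

open Classical in
/-- Few `n × (n + 1)` matrices in a box of side `L` have all maximal minors divisible by a common
prime greater than `L`. -/
theorem exists_card_minors_dvd_le (n : ℕ) : ∃ C : ℕ, ∀ (a b : ℤ) (L : ℕ), b - a = L → -L ≤ a →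
    b ≤ L → ((Fintype.piFinset fun _ : Fin n => Fintype.piFinset fun _ : Fin (n + 1) =>
      Finset.Ico a b).filter fun M => ∃ p : ℕ, p.Prime ∧ L < p ∧ ∀ j : Fin (n + 1),
        (p : ℤ) ∣ ((Matrix.of M).submatrix id j.succAbove).det).card * L ≤
      C * L ^ (n * (n + 1)) := by
  induction n with
  | zero =>
    -- The empty determinant is 1, so no matrix is counted.
    refine ⟨0, fun a b L _ _ _ => ?_⟩
    rw [Finset.filter_false_of_mem]
    · simp
    · rintro M _ ⟨p, hp, _, h⟩
      have := h 0
      rw [Matrix.det_fin_zero] at this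
      exact (Nat.prime_iff_prime_int.1 hp).not_dvd_one this
  | succ n ih =>
    obtain ⟨C, hC⟩ := ih
    -- The factorial comes from the bound `n! * L ^ n` on an `n × n` minor, which makes it the `K`
    -- of `card_pairs_dvd_le`.
    refine ⟨C + (1 + (n + 1 + (n + 1) * n.factorial)), fun a b L hL ha hb => ?_⟩
    let X := Fintype.piFinset fun _ : Fin (n + 1) => Finset.Ico a b
    let Y := Fintype.piFinset fun _ : Fin n => X
    have hX : X.card = L ^ (n + 1) := by simp [X, Fintype.card_piFinset, hL]
    have hY : Y.card = L ^ (n * (n + 1)) := by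
      simp [Y, Fintype.card_piFinset, hX, ← pow_mul, mul_comm]
    let c : (Fin n → Fin (n + 1) → ℤ) → Fin (n + 1) → ℤ := fun A i =>
      (-1) ^ (i : ℕ) * ((Matrix.of A).submatrix id i.succAbove).det
    let bad : (Fin n → Fin (n + 1) → ℤ) → Prop := fun A => ∃ p : ℕ, p.Prime ∧ L < p ∧
      ∀ j : Fin (n + 1), (p : ℤ) ∣ ((Matrix.of A).submatrix id j.succAbove).det
    let dvdPair : (Fin n → Fin (n + 1) → ℤ) → (Fin (n + 1) → ℤ) × (Fin (n + 1) → ℤ) → Prop :=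
      fun A w => ∃ p : ℕ, p.Prime ∧ L < p ∧ (p : ℤ) ∣ ∑ i, c A i * w.1 i ∧
        (p : ℤ) ∣ ∑ i, c A i * w.2 i
    have hlap : ∀ (A : Fin n → Fin (n + 1) → ℤ) (u : Fin (n + 1) → ℤ),
        (Matrix.of fun i => Fin.cons (u i) fun j => A j i : Matrix (Fin (n + 1)) (Fin (n + 1)) ℤ).det
          = ∑ i, c A i * u i := by
      intro A u
      rw [Matrix.det_succ_column_zero]
      refine Finset.sum_congr rfl fun i _ => ?_
      rw [← Matrix.det_transpose (Matrix.submatrix _ _ _)]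
      have : (Matrix.submatrix (Matrix.of fun i => Fin.cons (u i) fun j => A j i :
          Matrix (Fin (n + 1)) (Fin (n + 1)) ℤ) i.succAbove Fin.succ).transpose =
          (Matrix.of A).submatrix id i.succAbove := by
        ext j k
        simp
      rw [this]
      simp [c]
      ring
    -- Two columns are split off and the rest is transposed to an `n × (n + 1)` matrix `A`. The
    -- minors omitting column 1 and column 0 are one linear form evaluated at columns 0 and 1, its
    -- coefficients being the signed maximal minors of `A`. Induction handles the bad `A`, the count
    -- of pairs all others.
    let F : (Fin (n + 1) → Fin (n + 2) → ℤ) →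
        (Fin n → Fin (n + 1) → ℤ) × (Fin (n + 1) → ℤ) × (Fin (n + 1) → ℤ) :=
      fun M => (fun j i => M i j.succ.succ, fun i => M i 0, fun i => M i 1)
    have hF : Function.Injective F := by
      intro M N h
      funext i j
      simp only [F, Prod.mk.injEq] at h
      refine Fin.cases ?_ (fun j => Fin.cases ?_ (fun j => ?_) j) j
      · exact congrFun h.2.1 i
      · exact congrFun h.2.2 i
      · exact congrFun (congrFun h.1 j) i
    have hsub : ∀ M ∈ ((Fintype.piFinset fun _ : Fin (n + 1) => Fintype.piFinset
        fun _ : Fin (n + 2) => Finset.Ico a b).filter fun M => ∃ p : ℕ, p.Prime ∧ L < p ∧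
          ∀ j : Fin (n + 2), (p : ℤ) ∣ ((Matrix.of M).submatrix id j.succAbove).det),
        F M ∈ ((Y.filter bad) ×ˢ (X ×ˢ X)) ∪ (Y.filter (¬ bad ·)).biUnion fun A =>
          {A} ×ˢ ((X ×ˢ X).filter (dvdPair A)) := by
      intro M hM
      simp only [Finset.mem_filter, Fintype.mem_piFinset] at hM
      obtain ⟨hM, p, hp, hLp, hdvd⟩ := hM
      have hA : (F M).1 ∈ Y := by
        simp only [Y, X, F, Fintype.mem_piFinset]
        exact fun _ _ => hM _ _
      have hu : (F M).2.1 ∈ X := by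
        simp only [X, F, Fintype.mem_piFinset]
        exact fun _ => hM _ _
      have hv : (F M).2.2 ∈ X := by
        simp only [X, F, Fintype.mem_piFinset]
        exact fun _ => hM _ _
      simp only [Finset.mem_union, Finset.mem_product, Finset.mem_filter, Finset.mem_biUnion,
        Finset.mem_singleton]
      by_cases hb : bad (F M).1
      · exact Or.inl ⟨⟨hA, hb⟩, hu, hv⟩
      · refine Or.inr ⟨(F M).1, ⟨hA, hb⟩, rfl, ⟨hu, hv⟩, p, hp, hLp, ?_, ?_⟩
        · rw [← hlap]
          convert hdvd 1 using 2
          ext i j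
          refine Fin.cases ?_ (fun j => ?_) j
          · simp [F]
          · simp [F]
        · rw [← hlap]
          convert hdvd 0 using 2
          ext i j
          refine Fin.cases ?_ (fun j => ?_) j
          · simp [F]
          · simp [F]
    have hcard := Finset.card_le_card_of_injOn F hsub hF.injOn
    refine (Nat.mul_le_mul_right L (hcard.trans (Finset.card_union_le _ _))).trans ?_
    have h1 := hC a b L hL ha hb
    have h2 : ((Y.filter (¬ bad ·)).biUnion fun A =>
          ({A} : Finset (Fin n → Fin (n + 1) → ℤ)) ×ˢ ((X ×ˢ X).filter (dvdPair A))).card ≤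
        L ^ (n * (n + 1)) * ((1 + (n + 1 + (n + 1) * n.factorial)) * L ^ (2 * n + 1)) := by
      refine (Finset.card_biUnion_le_card_mul _ _
        ((1 + (n + 1 + (n + 1) * n.factorial)) * L ^ (2 * n + 1)) fun A hA => ?_).trans
        (Nat.mul_le_mul_right _ ((Finset.card_filter_le _ _).trans hY.le))
      rw [Finset.card_product, Finset.card_singleton, one_mul]
      rw [Finset.mem_filter] at hA
      refine card_pairs_dvd_le hL ha hb (c A) ?_ ?_
      · intro p hp hLp
        by_contra! h
        refine hA.2 ⟨p, hp, hLp, fun j => ?_⟩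
        have := h j
        rcases neg_one_pow_eq_or ℤ (j : ℕ) with h' | h' <;> simpa [c, h'] using this
      · intro i
        have : |c A i| = |((Matrix.of A).submatrix id i.succAbove).det| := by
          simp [c, abs_mul]
        rw [this]
        have := Matrix.det_le (A := (Matrix.of A).submatrix id i.succAbove)
          (abv := AbsoluteValue.abs) (x := (L : ℤ)) ?_
        · simpa using this
        · intro j k
          have := Fintype.mem_piFinset.1 (Fintype.mem_piFinset.1 hA.1 j) (i.succAbove k)
          rw [Finset.mem_Ico] at this
          exact abs_le.2 ⟨by simp; omega, by simp; omega⟩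
    rw [Finset.card_product, Finset.card_product, hX, add_mul]
    calc _ ≤ ((Y.filter bad).card * L) * (L ^ (n + 1) * L ^ (n + 1)) +
          L ^ (n * (n + 1)) * ((1 + (n + 1 + (n + 1) * n.factorial)) * L ^ (2 * n + 1)) * L := by
          refine add_le_add (le_of_eq (by ring)) (Nat.mul_le_mul_right _ h2)
      _ ≤ (C * L ^ (n * (n + 1))) * (L ^ (n + 1) * L ^ (n + 1)) +
          L ^ (n * (n + 1)) * ((1 + (n + 1 + (n + 1) * n.factorial)) * L ^ (2 * n + 1)) * L :=
          Nat.add_le_add_right (Nat.mul_le_mul_right _ h1) _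
      _ = _ := by ring

/-! ### Counting residue classes in boxes -/

theorem abs_card_residue_sub_le {a b : ℤ} {L N : ℕ} (hL : b - a = L) (hN : 0 < N) (t : ZMod N) :
    |(((Finset.Ico a b).filter fun x : ℤ => (x : ZMod N) = t).card : ℝ) - L / N| ≤ 1 := by
  obtain ⟨v, rfl⟩ := ZMod.intCast_surjective t
  have h1 : (Finset.Ico a b).filter (fun x : ℤ => (x : ZMod N) = (v : ZMod N)) =
      (Finset.Ico a b).filter fun x => x ≡ v [ZMOD N] := by
    refine Finset.filter_congr fun x _ => ?_
    rw [ZMod.intCast_eq_intCast_iff]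
  have h2 := Int.Ico_filter_modEq_card a b (r := (N : ℤ)) (by exact_mod_cast hN) v
  rw [h1]
  set k := ((Finset.Ico a b).filter fun x => x ≡ v [ZMOD N]).card
  set y : ℚ := ((b : ℚ) - v) / (N : ℤ) with hy
  set z : ℚ := ((a : ℚ) - v) / (N : ℤ) with hz
  have hNq : (0 : ℚ) < N := by exact_mod_cast hN
  have hyz : y - z = L / N := by
    rw [hy, hz, ← sub_div]
    have : (b : ℚ) - a = L := by exact_mod_cast hL
    rw [sub_sub_sub_cancel_right, this]
    simp
  have hLN : (0 : ℚ) ≤ L / N := by positivity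
  have hyz0 : ⌈z⌉ ≤ ⌈y⌉ := Int.ceil_le_ceil (by linarith)
  rw [max_eq_left (by omega)] at h2
  have h3 : (k : ℚ) = ⌈y⌉ - ⌈z⌉ := by exact_mod_cast h2
  have h4 : |(k : ℚ) - L / N| ≤ 1 := by
    rw [h3, ← hyz, abs_le]
    have := Int.le_ceil y
    have := Int.le_ceil z
    have := Int.ceil_lt_add_one y
    have := Int.ceil_lt_add_one z
    constructor <;> linarith
  have h5 : ((|(k : ℚ) - L / N| : ℚ) : ℝ) ≤ ((1 : ℚ) : ℝ) := Rat.cast_le.2 h4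
  push_cast at h5
  exact h5

theorem card_box_residue_eq {ι : Type*} [Fintype ι] [DecidableEq ι] (I : Finset ℤ) {N : ℕ}
    [NeZero N] (T : Finset (ι → ZMod N)) :
    ((Fintype.piFinset fun _ : ι => I).filter fun x => (fun i => (x i : ZMod N)) ∈ T).card =
      ∑ t ∈ T, ∏ i, (I.filter fun x : ℤ => (x : ZMod N) = t i).card := by
  refine (Finset.card_eq_sum_card_fiberwise (f := fun (x : ι → ℤ) i => (x i : ZMod N)) (t := T)
    fun x hx => (Finset.mem_filter.1 hx).2).trans ?_
  refine Finset.sum_congr rfl fun t ht => ?_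
  rw [← Fintype.card_piFinset]
  congr 1
  ext x
  simp only [Finset.mem_filter, Fintype.mem_piFinset, funext_iff]
  refine ⟨fun h i => ⟨h.1.1 i, h.2 i⟩, fun h => ⟨⟨fun i => (h i).1, ?_⟩, fun i => (h i).2⟩⟩
  rwa [show (fun i => (x i : ZMod N)) = t from funext fun i => (h i).2]

theorem card_box_residue_le {ι : Type*} [Fintype ι] [DecidableEq ι] {a b : ℤ} {L N : ℕ}
    [NeZero N] (hL : b - a = L) (hNL : N ≤ L) (T : Finset (ι → ZMod N)) :
    (((Fintype.piFinset fun _ : ι => Finset.Ico a b).filter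
      fun x => (fun i => (x i : ZMod N)) ∈ T).card : ℝ) ≤
      T.card * (2 * L / N) ^ Fintype.card ι := by
  have hN : (0 : ℝ) < N := by exact_mod_cast NeZero.pos N
  rw [card_box_residue_eq, Nat.cast_sum, ← nsmul_eq_mul]
  refine Finset.sum_le_card_nsmul _ _ _ fun t _ => ?_
  rw [Nat.cast_prod]
  refine (Finset.prod_le_prod (g := fun _ => 2 * (L : ℝ) / N) (fun _ _ => by positivity)
    fun i _ => ?_).trans (le_of_eq (by simp [div_pow]))
  have h1 := (abs_le.1 (abs_card_residue_sub_le hL (NeZero.pos N) (t i))).2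
  -- As `N ≤ L`, the rounding error 1 is absorbed by doubling the main term.
  have h2 : (1 : ℝ) ≤ L / N := by
    rw [le_div_iff₀ hN]
    simpa using (by exact_mod_cast hNL : (N : ℝ) ≤ L)
  rw [mul_div_assoc]
  linarith

/-! ### Density of sets given by congruences -/

/-- The integer points of `[-B, B[`. -/
noncomputable def intervalPoints (B : ℝ) : Finset ℤ := Finset.Ico ⌈-B⌉ ⌈B⌉

theorem integerBox_eq {ι : Type*} [Fintype ι] [DecidableEq ι] (B : ℝ) :
    integerBox ι B = ↑(Fintype.piFinset fun _ : ι => intervalPoints B) := by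
  ext x
  simp [integerBox, intervalPoints, Int.ceil_le, Int.lt_ceil]

theorem ncard_inter_integerBox {ι : Type*} [Fintype ι] [DecidableEq ι] (S : Set (ι → ℤ))
    [DecidablePred (· ∈ S)] (B : ℝ) : (S ∩ integerBox ι B).ncard =
      ((Fintype.piFinset fun _ : ι => intervalPoints B).filter (· ∈ S)).card := by
  rw [integerBox_eq, ← Set.ncard_coe_finset]
  congr 1
  ext x
  simp [and_comm]

/-- The number of integer points of `[-B, B[`. -/
noncomputable def intervalLength (B : ℝ) : ℕ := (⌈B⌉ - ⌈-B⌉).toNat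

theorem ceil_sub_ceil_neg {B : ℝ} (hB : 0 ≤ B) : ⌈B⌉ - ⌈-B⌉ = intervalLength B := by
  have : ⌈-B⌉ ≤ ⌈B⌉ := Int.ceil_le_ceil (by linarith)
  unfold intervalLength
  omega

theorem abs_intervalLength_sub_le {B : ℝ} (hB : 0 ≤ B) : |(intervalLength B : ℝ) - 2 * B| ≤ 1 := by
  have h : (intervalLength B : ℝ) = ⌈B⌉ - ⌈-B⌉ := by exact_mod_cast (ceil_sub_ceil_neg hB).symm
  rw [h, abs_le]
  have := Int.le_ceil B
  have := Int.le_ceil (-B)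
  have := Int.ceil_lt_add_one B
  have := Int.ceil_lt_add_one (-B)
  constructor <;> linarith

/-- A set of integer points determined by residues modulo `N` has the expected density. -/
theorem hasDensity_of_residues {ι : Type*} [Fintype ι] [DecidableEq ι] {N : ℕ} [NeZero N]
    (T : Finset (ι → ZMod N)) :
    HasDensity {x : ι → ℤ | (fun i => (x i : ZMod N)) ∈ T} (T.card / (N : ℝ) ^ Fintype.card ι) := by
  classical
  unfold HasDensity
  have hN : (0 : ℝ) < N := by exact_mod_cast NeZero.pos N
  have hfac : ∀ t : ZMod N, Tendsto (fun B : ℝ =>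
      (((intervalPoints B).filter fun x : ℤ => (x : ZMod N) = t).card : ℝ) / (2 * B))
      atTop (𝓝 (1 / N)) := by
    intro t
    rw [tendsto_iff_norm_sub_tendsto_zero]
    refine squeeze_zero' (Eventually.of_forall fun _ => norm_nonneg _)
      (g := fun B : ℝ => 1 * B⁻¹) ?_ (by simpa using tendsto_inv_atTop_zero (𝕜 := ℝ))
    filter_upwards [eventually_gt_atTop 0] with B hB
    have h1 := abs_card_residue_sub_le (ceil_sub_ceil_neg hB.le) (NeZero.pos N) t
    have h2 := abs_intervalLength_sub_le hB.le
    change |(((intervalPoints B).filter fun x : ℤ => (x : ZMod N) = t).card : ℝ) - _| ≤ 1 at h1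
    set k := (((intervalPoints B).filter fun x : ℤ => (x : ZMod N) = t).card : ℝ)
    have h3 : |(intervalLength B : ℝ) / N - 2 * B / N| ≤ 1 := by
      rw [← sub_div, abs_div, abs_of_pos hN, div_le_one hN]
      exact h2.trans (by exact_mod_cast NeZero.pos N)
    have h4 : |k - 2 * B / N| ≤ 2 := by
      have := abs_sub_le k ((intervalLength B : ℝ) / N) (2 * B / N)
      linarith
    have h5 : k / (2 * B) - 1 / N = (k - 2 * B / N) / (2 * B) := by
      field_simp
    rw [Real.norm_eq_abs, h5, abs_div, abs_of_pos (by linarith : 0 < 2 * B),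
      div_le_iff₀ (by linarith)]
    refine h4.trans (le_of_eq ?_)
    field_simp
  have hlim : Tendsto (fun B : ℝ => ∑ t ∈ T, ∏ i,
      (((intervalPoints B).filter fun x : ℤ => (x : ZMod N) = t i).card : ℝ) / (2 * B))
      atTop (𝓝 (∑ t ∈ T, ∏ _i : ι, (1 / (N : ℝ)))) :=
    tendsto_finsetSum _ fun t _ => tendsto_finsetProd _ fun i _ => hfac (t i)
  have hval : ∑ t ∈ T, ∏ _i : ι, (1 / (N : ℝ)) = T.card / (N : ℝ) ^ Fintype.card ι := by
    simp [div_eq_mul_inv]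
  rw [hval] at hlim
  refine hlim.congr fun B => ?_
  rw [ncard_inter_integerBox]
  simp only [Set.mem_ofPred_eq]
  rw [card_box_residue_eq, Nat.cast_sum, Finset.sum_div]
  refine Finset.sum_congr rfl fun t _ => ?_
  rw [Nat.cast_prod, Finset.prod_div_distrib]
  simp

/-! ### Matrices with dependent rows modulo one prime -/

open Classical in
theorem card_linearIndependent_rows {n m : ℕ} (h : n ≤ m) (p : ℕ) [Fact p.Prime] :
    ((Finset.univ.filter fun y : Fin n × Fin m → ZMod p =>
      LinearIndependent (ZMod p) fun (i : Fin n) (j : Fin m) => y (i, j)).card : ℝ) =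
      (p : ℝ) ^ (n * m) * ∏ i ∈ Finset.range n, (1 - 1 / (p : ℝ) ^ (m - i)) := by
  have hp : (0 : ℝ) < p := by exact_mod_cast (Fact.out : p.Prime).pos
  have h1 := card_linearIndependent (K := ZMod p) (V := Fin m → ZMod p) (k := n) (by simpa using h)
  have h2 : (Finset.univ.filter fun y : Fin n × Fin m → ZMod p =>
      LinearIndependent (ZMod p) fun (i : Fin n) (j : Fin m) => y (i, j)).card =
      Nat.card { s : Fin n → Fin m → ZMod p // LinearIndependent (ZMod p) s } := by
    rw [Nat.card_eq_fintype_card, Fintype.card_subtype]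
    refine Finset.card_equiv (Equiv.curry (Fin n) (Fin m) (ZMod p)) fun y => ?_
    simp only [Finset.mem_filter, Finset.mem_univ, true_and]
    rfl
  rw [h2, h1]
  simp only [ZMod.card, Module.finrank_fin_fun]
  rw [Nat.cast_prod, pow_mul', ← Finset.prod_range fun i => ((p ^ m - p ^ i : ℕ) : ℝ),
    ← Finset.card_range n, ← Finset.prod_const, Finset.card_range, ← Finset.prod_mul_distrib]
  refine Finset.prod_congr rfl fun i hi => ?_
  have him : i ≤ m := (Finset.mem_range.1 hi).le.trans h
  rw [Nat.cast_sub (Nat.pow_le_pow_right (Fact.out : p.Prime).pos him)]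
  push_cast
  have : (p : ℝ) ^ m = p ^ (m - i) * p ^ i := by rw [← pow_add, Nat.sub_add_cancel him]
  rw [this]
  field_simp

theorem one_sub_prod_one_sub_le_sum {ι : Type*} (s : Finset ι) (f : ι → ℝ)
    (h0 : ∀ i ∈ s, 0 ≤ f i) (h1 : ∀ i ∈ s, f i ≤ 1) :
    1 - ∏ i ∈ s, (1 - f i) ≤ ∑ i ∈ s, f i := by
  classical
  induction s using Finset.induction_on with
  | empty => simp
  | insert a s ha ih =>
    rw [Finset.prod_insert ha, Finset.sum_insert ha]
    have h2 := ih (fun i hi => h0 i (Finset.mem_insert_of_mem hi))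
      (fun i hi => h1 i (Finset.mem_insert_of_mem hi))
    have h3 : ∏ i ∈ s, (1 - f i) ≤ 1 := Finset.prod_le_one
      (fun i hi => by linarith [h1 i (Finset.mem_insert_of_mem hi)])
      (fun i hi => by linarith [h0 i (Finset.mem_insert_of_mem hi)])
    nlinarith [h0 a (Finset.mem_insert_self _ _)]

-- Every exponent `m - i` with `i < n < m` is at least 2; this is what makes the sum over primes
-- converge.
open Classical in
theorem card_not_linearIndependent_rows_le {n m : ℕ} (h : n < m) (p : ℕ) [Fact p.Prime] :
    ((Finset.univ.filter fun y : Fin n × Fin m → ZMod p =>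
      ¬ LinearIndependent (ZMod p) fun (i : Fin n) (j : Fin m) => y (i, j)).card : ℝ) ≤
      (p : ℝ) ^ (n * m) * (n / (p : ℝ) ^ 2) := by
  have hp : (1 : ℝ) ≤ p := by exact_mod_cast (Fact.out : p.Prime).one_le
  have h1 := card_linearIndependent_rows h.le p
  have h2 := Finset.card_filter_add_card_filter_not (s := Finset.univ)
    (fun y : Fin n × Fin m → ZMod p =>
      LinearIndependent (ZMod p) fun (i : Fin n) (j : Fin m) => y (i, j))
  have h3 : (Finset.univ : Finset (Fin n × Fin m → ZMod p)).card = p ^ (n * m) := by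
    simp [ZMod.card]
  rw [h3] at h2
  have h4 := congrArg (Nat.cast : ℕ → ℝ) h2
  push_cast at h4
  have h5 := one_sub_prod_one_sub_le_sum (Finset.range n) (fun i => 1 / (p : ℝ) ^ (m - i))
    (fun i _ => by positivity)
    (fun i _ => by rw [div_le_one (by positivity)]; exact one_le_pow₀ hp)
  have h6 : ∑ i ∈ Finset.range n, 1 / (p : ℝ) ^ (m - i) ≤ n / (p : ℝ) ^ 2 := by
    refine (Finset.sum_le_card_nsmul _ _ (1 / (p : ℝ) ^ 2) fun i hi => ?_).trans (le_of_eq ?_)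
    · have := Finset.mem_range.1 hi
      exact one_div_le_one_div_of_le (by positivity) (pow_le_pow_right₀ hp (by omega))
    · simp [div_eq_mul_inv]
  have h7 : (0 : ℝ) ≤ (p : ℝ) ^ (n * m) := by positivity
  nlinarith [mul_le_mul_of_nonneg_left (h5.trans h6) h7]

open Classical in
theorem card_box_not_rowsIndepMod_le {n m : ℕ} (h : n < m) {a b : ℤ} {L p : ℕ} (hL : b - a = L)
    (hp : p.Prime) (hpL : p ≤ L) :
    (((Fintype.piFinset fun _ : Fin n × Fin m => Finset.Ico a b).filter
      fun x => ¬ RowsIndepMod p x).card : ℝ) ≤ n * (2 * L) ^ (n * m) * ((p : ℝ) ^ 2)⁻¹ := by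
  have : Fact p.Prime := ⟨hp⟩
  have hp0 : (0 : ℝ) < p := by exact_mod_cast hp.pos
  have h1 := card_box_residue_le (ι := Fin n × Fin m) hL hpL
    (Finset.univ.filter fun y : Fin n × Fin m → ZMod p =>
      ¬ LinearIndependent (ZMod p) fun (i : Fin n) (j : Fin m) => y (i, j))
  simp only [Finset.mem_filter, Finset.mem_univ, true_and] at h1
  refine h1.trans ((mul_le_mul_of_nonneg_right (card_not_linearIndependent_rows_le h p)
    (by positivity)).trans (le_of_eq ?_))
  simp only [Fintype.card_prod, Fintype.card_fin, div_pow]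
  field_simp

open Classical in
/-- Few matrices in a box of side `L` have dependent rows modulo some prime greater than `L`. -/
theorem exists_card_box_not_rowsIndepMod_le {n m : ℕ} (h : n < m) : ∃ C : ℕ, ∀ (a b : ℤ) (L : ℕ),
    b - a = L → -L ≤ a → b ≤ L → ((Fintype.piFinset fun _ : Fin n × Fin m =>
      Finset.Ico a b).filter fun x => ∃ p : ℕ, p.Prime ∧ L < p ∧ ¬ RowsIndepMod p x).card * L ≤
      C * L ^ (n * m) := by
  obtain ⟨k, rfl⟩ := Nat.exists_eq_add_of_le (Nat.succ_le_of_lt h)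
  obtain ⟨C, hC⟩ := exists_card_minors_dvd_le n
  refine ⟨C, fun a b L hL ha hb => ?_⟩
  have hCL := hC a b L hL ha hb
  -- Only the first `n + 1` columns matter: a minor among them prime to `p` would make the rows
  -- independent. The other `n * k` entries are free.
  let F : (Fin n × Fin (n + 1 + k) → ℤ) → (Fin n → Fin (n + 1) → ℤ) × (Fin n × Fin k → ℤ) :=
    fun x => (fun i j => x (i, Fin.castAdd k j), fun q => x (q.1, Fin.natAdd (n + 1) q.2))
  have hF : Function.Injective F := by
    intro x y hxy
    simp only [F, Prod.mk.injEq] at hxy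
    funext ⟨i, j⟩
    refine Fin.addCases (fun j => ?_) (fun j => ?_) j
    · exact congrFun (congrFun hxy.1 i) j
    · exact congrFun hxy.2 (i, j)
  have hcard := Finset.card_le_card_of_injOn F
    (s := (Fintype.piFinset fun _ : Fin n × Fin (n + 1 + k) =>
      Finset.Ico a b).filter fun x => ∃ p : ℕ, p.Prime ∧ L < p ∧ ¬ RowsIndepMod p x)
    (t := ((Fintype.piFinset fun _ : Fin n => Fintype.piFinset fun _ : Fin (n + 1) =>
      Finset.Ico a b).filter fun M => ∃ p : ℕ, p.Prime ∧ L < p ∧ ∀ j : Fin (n + 1),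
        (p : ℤ) ∣ ((Matrix.of M).submatrix id j.succAbove).det) ×ˢ
      (Fintype.piFinset fun _ : Fin n × Fin k => Finset.Ico a b)) ?_ hF.injOn
  · refine (Nat.mul_le_mul_right L hcard).trans ?_
    rw [Finset.card_product]
    have h1 : (Fintype.piFinset fun _ : Fin n × Fin k => Finset.Ico a b).card = L ^ (n * k) := by
      simp [Fintype.card_piFinset, hL]
    rw [h1, mul_right_comm]
    refine (Nat.mul_le_mul_right _ hCL).trans (le_of_eq ?_)
    rw [Nat.succ_eq_add_one]
    ring
  · intro x hx
    simp only [Finset.coe_filter, Set.mem_ofPred_eq, Fintype.mem_piFinset] at hx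
    obtain ⟨hx, p, hp, hLp, hdep⟩ := hx
    simp only [Finset.coe_product, Set.mem_prod, Finset.mem_coe, Finset.mem_filter,
      Fintype.mem_piFinset]
    refine ⟨⟨fun i j => hx _, p, hp, hLp, fun j => ?_⟩, fun q => hx _⟩
    have : Fact p.Prime := ⟨hp⟩
    by_contra hdvd
    apply hdep
    have hu : IsUnit (((Matrix.of (F x).1).submatrix id j.succAbove).map
        (Int.castRingHom (ZMod p))) := by
      rw [Matrix.isUnit_iff_isUnit_det, ← RingHom.mapMatrix_apply, ← RingHom.map_det,
        isUnit_iff_ne_zero]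
      simpa [ZMod.intCast_zmod_eq_zero_iff_dvd] using hdvd
    have hli := Matrix.linearIndependent_rows_iff_isUnit.2 hu
    exact LinearIndependent.of_comp
      (LinearMap.funLeft (ZMod p) (ZMod p) fun l => Fin.castAdd k (j.succAbove l)) hli

/-! ### Finitely many primes and the Euler product -/

/-- The density of the matrices whose rows are independent modulo each prime below `P`. -/
theorem hasDensity_rowsIndepMod_primesBelow {n m : ℕ} (h : n ≤ m) (P : ℕ) :
    HasDensity {x : Fin n × Fin m → ℤ | ∀ p ∈ P.primesBelow, RowsIndepMod p x}
      (∏ p ∈ P.primesBelow, ∏ i ∈ Finset.range n, (1 - 1 / (p : ℝ) ^ (m - i))) := by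
  classical
  let q : P.primesBelow → ℕ := fun p => p
  have hq : ∀ p, (q p).Prime := fun p => Nat.prime_of_mem_primesBelow p.2
  have hfact : ∀ p, Fact (q p).Prime := fun p => ⟨hq p⟩
  have hco : Pairwise (Function.onFun Nat.Coprime q) := fun p p' hpp' =>
    (Nat.coprime_primes (hq p) (hq p')).2 fun he => hpp' (Subtype.ext he)
  -- By the Chinese remainder theorem, a residue matrix modulo the product is an independent choice
  -- of one modulo each prime.
  let e := ZMod.prodEquivPi q hco
  have hNZ : NeZero (∏ p, q p) := ⟨Finset.prod_ne_zero_iff.2 fun p _ => (hq p).ne_zero⟩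
  let good : ∀ p, Finset (Fin n × Fin m → ZMod (q p)) := fun p =>
    Finset.univ.filter fun y => LinearIndependent (ZMod (q p)) fun i j => y (i, j)
  let T : Finset (Fin n × Fin m → ZMod (∏ p, q p)) :=
    Finset.univ.filter fun t => ∀ p, (fun ij => e (t ij) p) ∈ good p
  have hT : T.card = ∏ p, (good p).card := by
    rw [← Fintype.card_piFinset]
    refine Finset.card_equiv ((Equiv.arrowCongr (Equiv.refl _) e.toEquiv).trans
      (Equiv.piComm fun (_ : Fin n × Fin m) p => ZMod (q p))) fun t => ?_
    simp only [T, Finset.mem_filter, Finset.mem_univ, true_and, Fintype.mem_piFinset]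
    rfl
  have hd := hasDensity_of_residues T
  have hset : {x : Fin n × Fin m → ℤ | ∀ p ∈ P.primesBelow, RowsIndepMod p x} =
      {x | (fun i => (x i : ZMod (∏ p, q p))) ∈ T} := by
    ext x
    simp only [T, good, Set.mem_ofPred_eq, Finset.mem_filter, Finset.mem_univ, true_and,
      map_intCast, Pi.intCast_apply]
    exact ⟨fun hx p => hx p p.2, fun hx p hp => hx ⟨p, hp⟩⟩
  have hval : (T.card : ℝ) / ((∏ p, q p : ℕ) : ℝ) ^ Fintype.card (Fin n × Fin m) =
      ∏ p ∈ P.primesBelow, ∏ i ∈ Finset.range n, (1 - 1 / (p : ℝ) ^ (m - i)) := by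
    rw [hT, Nat.cast_prod, Nat.cast_prod, ← Finset.prod_pow, ← Finset.prod_div_distrib,
      ← Finset.prod_coe_sort P.primesBelow]
    refine Finset.prod_congr rfl fun p _ => ?_
    have hp0 : (0 : ℝ) < q p := by exact_mod_cast (hq p).pos
    rw [card_linearIndependent_rows h (q p)]
    simp only [Fintype.card_prod, Fintype.card_fin]
    rw [mul_div_cancel_left₀ _ (by positivity)]
  rw [hset, ← hval]
  exact hd

theorem exists_tendsto_prod_primesBelow {n m : ℕ} (h : n < m) : ∃ d : ℝ,
    Tendsto (fun P : ℕ => ∏ p ∈ P.primesBelow, ∏ i ∈ Finset.range n,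
      (1 - 1 / (p : ℝ) ^ (m - i))) atTop (𝓝 d) ∧
    (d : ℂ) = ∏ i ∈ Finset.range n, 1 / riemannZeta ((m : ℂ) - (i : ℂ)) := by
  have hre : ∀ i ∈ Finset.range n, 1 < ((m : ℂ) - (i : ℂ)).re := by
    intro i hi
    have hi := Finset.mem_range.1 hi
    have h1 : ((m : ℂ) - (i : ℂ)).re = (m : ℝ) - i := by simp
    have h2 : (i : ℝ) + 2 ≤ m := by exact_mod_cast (by omega : i + 2 ≤ m)
    rw [h1]
    linarith
  have hlim : Tendsto (fun P : ℕ => ∏ i ∈ Finset.range n, 1 / ∏ p ∈ P.primesBelow,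
      (1 - (p : ℂ) ^ (-((m : ℂ) - (i : ℂ))))⁻¹) atTop
      (𝓝 (∏ i ∈ Finset.range n, 1 / riemannZeta ((m : ℂ) - (i : ℂ)))) := by
    refine tendsto_finsetProd _ fun i hi => ?_
    exact tendsto_const_nhds.div (riemannZeta_eulerProduct (hre i hi))
      (riemannZeta_ne_zero_of_one_lt_re (hre i hi))
  have heq : ∀ P : ℕ, ∏ i ∈ Finset.range n, 1 / ∏ p ∈ P.primesBelow,
      (1 - (p : ℂ) ^ (-((m : ℂ) - (i : ℂ))))⁻¹ =
      ((∏ p ∈ P.primesBelow, ∏ i ∈ Finset.range n, (1 - 1 / (p : ℝ) ^ (m - i)) : ℝ) : ℂ) := by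
    intro P
    rw [Finset.prod_comm]
    push_cast
    refine Finset.prod_congr rfl fun i hi => ?_
    have hi := Finset.mem_range.1 hi
    rw [Finset.prod_inv_distrib, one_div, inv_inv]
    refine Finset.prod_congr rfl fun p hp => ?_
    have : (m : ℂ) - (i : ℂ) = ((m - i : ℕ) : ℂ) := by
      rw [Nat.cast_sub (by omega)]
    rw [this, Complex.cpow_neg, Complex.cpow_natCast, one_div]
  simp only [heq] at hlim
  -- The partial products are real, so real parts give a real limit, which uniqueness of limits
  -- identifies with the complex one.
  have hlim_re := (Complex.continuous_re.tendsto _).comp hlim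
  refine ⟨_, hlim_re, ?_⟩
  exact tendsto_nhds_unique ((Complex.continuous_ofReal.tendsto _).comp hlim_re) hlim

/-! ### Passage to all primes -/

/-- Up to a small proportion, the matrices whose rows are independent modulo each prime `≤ P` have
rows independent modulo every prime. -/
theorem exists_abs_sub_density_le {n m : ℕ} (h : n < m) : ∃ a c : ℝ, ∀ (P : ℕ) (B : ℝ), 1 ≤ B →
    |(({x : Fin n × Fin m → ℤ | ∀ p : ℕ, p.Prime → RowsIndepMod p x} ∩
          integerBox (Fin n × Fin m) B).ncard : ℝ) / (2 * B) ^ Fintype.card (Fin n × Fin m) -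
      (({x : Fin n × Fin m → ℤ | ∀ p ∈ (P + 1).primesBelow, RowsIndepMod p x} ∩
          integerBox (Fin n × Fin m) B).ncard : ℝ) / (2 * B) ^ Fintype.card (Fin n × Fin m)| ≤
      a * (2 / (P + 1)) + c / B := by
  classical
  obtain ⟨C, hC⟩ := exists_card_box_not_rowsIndepMod_le h
  -- The powers of 4 and 2 come from `L ≤ 2 * (2 * B)`, valid as `B ≥ 1`.
  refine ⟨n * 4 ^ (n * m), C * 2 ^ (n * m), fun P B hB => ?_⟩
  set L := intervalLength B with hLdef
  have hL : ⌈B⌉ - ⌈-B⌉ = L := ceil_sub_ceil_neg (by linarith)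
  have hL1 := abs_le.1 (abs_intervalLength_sub_le (by linarith : 0 ≤ B))
  rw [← hLdef] at hL1
  have hLB : B ≤ L := by linarith
  have hLB' : (L : ℝ) ≤ 2 * (2 * B) := by linarith
  let X := Fintype.piFinset fun _ : Fin n × Fin m => intervalPoints B
  let G : Finset (Fin n × Fin m → ℤ) := X.filter fun x => ∀ p : ℕ, p.Prime → RowsIndepMod p x
  let G' : Finset (Fin n × Fin m → ℤ) :=
    X.filter fun x => ∀ p ∈ (P + 1).primesBelow, RowsIndepMod p x
  let E : Finset (Fin n × Fin m → ℤ) :=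
    X.filter fun x => ∃ p : ℕ, p.Prime ∧ L < p ∧ ¬ RowsIndepMod p x
  let E' : ℕ → Finset (Fin n × Fin m → ℤ) := fun p => X.filter fun x => p.Prime ∧ ¬ RowsIndepMod p x
  have hGG' : G ⊆ G' := by
    intro x hx
    simp only [G, G', Finset.mem_filter] at hx ⊢
    exact ⟨hx.1, fun p hp => hx.2 p (Nat.prime_of_mem_primesBelow hp)⟩
  -- A matrix in `G'` but not in `G` fails at a prime `p > P`; `E'` collects those with `p ≤ L`, `E`
  -- those with `p > L`.
  have hG' : G' ⊆ G ∪ (((Finset.Ioo P (L + 1)).biUnion E') ∪ E) := by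
    intro x hx
    by_cases hxG : x ∈ G
    · exact Finset.mem_union_left _ hxG
    · refine Finset.mem_union_right _ ?_
      simp only [G, G', Finset.mem_filter] at hx hxG
      have : ∃ p : ℕ, p.Prime ∧ ¬ RowsIndepMod p x := by
        by_contra! hall
        exact hxG ⟨hx.1, hall⟩
      obtain ⟨p, hp, hpx⟩ := this
      have hpP : P < p := by
        by_contra! hpP
        exact hpx (hx.2 p (Nat.mem_primesBelow.2 ⟨by omega, hp⟩))
      by_cases hpL : L < p
      · exact Finset.mem_union_right _ (Finset.mem_filter.2 ⟨hx.1, p, hp, hpL, hpx⟩)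
      · refine Finset.mem_union_left _ (Finset.mem_biUnion.2 ⟨p, ?_, ?_⟩)
        · exact Finset.mem_Ioo.2 ⟨hpP, by omega⟩
        · exact Finset.mem_filter.2 ⟨hx.1, hp, hpx⟩
  have hcard : (G'.card : ℝ) ≤ G.card + (∑ p ∈ Finset.Ioo P (L + 1), ((E' p).card : ℝ) + E.card) := by
    have := (Finset.card_le_card hG').trans ((Finset.card_union_le _ _).trans
      (Nat.add_le_add_left ((Finset.card_union_le _ _).trans
        (Nat.add_le_add_right Finset.card_biUnion_le _)) _))
    exact_mod_cast this
  have hE : (E.card : ℝ) ≤ (C * 2 ^ (n * m)) / B * (2 * B) ^ (n * m) := by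
    have hceil : 0 ≤ ⌈B⌉ := Int.ceil_nonneg (by linarith)
    have hceil_neg : ⌈-B⌉ ≤ 0 := Int.ceil_le.2 (by simp; linarith)
    have h1 : E.card * L ≤ C * L ^ (n * m) := hC ⌈-B⌉ ⌈B⌉ L hL
      (by omega) (by omega)
    have h2 : (E.card : ℝ) * L ≤ C * (L : ℝ) ^ (n * m) := by exact_mod_cast h1
    have h3 : (L : ℝ) ^ (n * m) ≤ 2 ^ (n * m) * (2 * B) ^ (n * m) := by
      rw [← mul_pow]
      exact pow_le_pow_left₀ (by positivity) hLB' _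
    rw [div_mul_eq_mul_div, le_div_iff₀ (by linarith)]
    calc (E.card : ℝ) * B ≤ E.card * L := by gcongr
      _ ≤ C * (L : ℝ) ^ (n * m) := h2
      _ ≤ C * (2 ^ (n * m) * (2 * B) ^ (n * m)) := by gcongr
      _ = _ := by ring
  have hE' : ∑ p ∈ Finset.Ioo P (L + 1), ((E' p).card : ℝ) ≤
      n * 4 ^ (n * m) * (2 / (P + 1)) * (2 * B) ^ (n * m) := by
    have h1 : ∀ p ∈ Finset.Ioo P (L + 1), ((E' p).card : ℝ) ≤
        n * (4 ^ (n * m) * (2 * B) ^ (n * m)) * ((p : ℝ) ^ 2)⁻¹ := by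
      intro p hp
      rw [Finset.mem_Ioo] at hp
      have h3 : (2 * (L : ℝ)) ^ (n * m) ≤ 4 ^ (n * m) * (2 * B) ^ (n * m) := by
        rw [← mul_pow]
        exact pow_le_pow_left₀ (by positivity) (by linarith) _
      by_cases hpp : p.Prime
      · have h2 := card_box_not_rowsIndepMod_le h hL hpp (by omega)
        simp only [E', hpp, true_and]
        refine h2.trans ?_
        gcongr
      · simp only [E', hpp, false_and, Finset.filter_false, Finset.card_empty, Nat.cast_zero]
        positivity
    refine (Finset.sum_le_sum h1).trans ?_
    rw [← Finset.mul_sum]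
    refine (mul_le_mul_of_nonneg_left (sum_Ioo_inv_sq_le P (L + 1)) (by positivity)).trans
      (le_of_eq (by ring))
  have hle : (G.card : ℝ) ≤ G'.card := by exact_mod_cast Finset.card_le_card hGG'
  have hpos : (0 : ℝ) < (2 * B) ^ (n * m) := by positivity
  have hGn : ({x : Fin n × Fin m → ℤ | ∀ p : ℕ, p.Prime → RowsIndepMod p x} ∩
      integerBox (Fin n × Fin m) B).ncard = G.card := by
    rw [ncard_inter_integerBox]
    congr 1
  have hGn' : ({x : Fin n × Fin m → ℤ | ∀ p ∈ (P + 1).primesBelow, RowsIndepMod p x} ∩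
      integerBox (Fin n × Fin m) B).ncard = G'.card := by
    rw [ncard_inter_integerBox]
    congr 1
    ext x
    simp [G', X]
  rw [hGn, hGn', Fintype.card_prod, Fintype.card_fin, Fintype.card_fin, ← sub_div, abs_div,
    abs_of_pos hpos, div_le_iff₀ hpos, abs_of_nonpos (by linarith), add_mul]
  linarith

/-- First `P` is fixed so that the tail term and `|dn P - d|` are small, then `B` grows; the four
errors get `ε / 4` each. -/
theorem tendsto_of_abs_sub_le {f : ℝ → ℝ} {g : ℕ → ℝ → ℝ} {dn : ℕ → ℝ} {d a c : ℝ}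
    (hg : ∀ P, Tendsto (g P) atTop (𝓝 (dn P))) (hdn : Tendsto dn atTop (𝓝 d))
    (hfg : ∀ (P : ℕ) (B : ℝ), 1 ≤ B → |f B - g P B| ≤ a * (2 / (P + 1)) + c / B) :
    Tendsto f atTop (𝓝 d) := by
  rw [Metric.tendsto_nhds]
  intro ε hε
  have ha : Tendsto (fun P : ℕ => a * (2 / ((P : ℝ) + 1))) atTop (𝓝 0) := by
    have := (tendsto_one_div_add_atTop_nhds_zero_nat (𝕜 := ℝ)).const_mul (a * 2)
    rw [mul_zero] at this
    refine this.congr fun P => by ring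
  have hc : Tendsto (fun B : ℝ => c / B) atTop (𝓝 0) := tendsto_const_nhds.div_atTop tendsto_id
  obtain ⟨P, hP1, hP2⟩ := ((Metric.tendsto_nhds.1 hdn (ε / 4) (by positivity)).and
    (ha.eventually_lt_const (by positivity : 0 < ε / 4))).exists
  filter_upwards [eventually_ge_atTop 1, Metric.tendsto_nhds.1 (hg P) (ε / 4) (by positivity),
    hc.eventually_lt_const (by positivity : 0 < ε / 4)] with B hB1 hB2 hB3
  rw [Real.dist_eq] at *
  have h1 := hfg P B hB1
  have h2 := abs_sub_le (f B) (g P B) d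
  have h3 := abs_sub_le (g P B) (dn P) d
  linarith

theorem mainTheorem3 (n m : ℕ) (hn : 0 < n) (hnm : n < m) :
    ∃ d : ℝ, HasDensity (rectangularUnimodularSet hnm) d ∧
      (d : ℂ) = ∏ i ∈ Finset.range n, 1 / riemannZeta ((m : ℂ) - (i : ℂ)) := by
  obtain ⟨d, hd, hdz⟩ := exists_tendsto_prod_primesBelow hnm
  refine ⟨d, ?_, hdz⟩
  obtain ⟨a, c, hac⟩ := exists_abs_sub_density_le hnm
  have hset : rectangularUnimodularSet hnm =
      {x : Fin n × Fin m → ℤ | ∀ p : ℕ, p.Prime → RowsIndepMod p x} :=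
    Set.ext fun x => isRectangularUnimodular_iff_rowsIndepMod hnm x
  rw [hset]
  exact tendsto_of_abs_sub_le
    (fun P => hasDensity_rowsIndepMod_primesBelow hnm.le (P + 1))
    (hd.comp (tendsto_add_atTop_nat 1)) hac
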